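/- Let $m\ge 2$ be an integer and $\delta\in(0,1)$. Then there exist constants $c_6,c_7>0$, depending only on $(m,\delta)$, such that the following holds. Let $X_0^*$ be a random variable with values in $\{1,2,3,\dots\}$ and $\mathbb P(X_0^*\ge 2)>0$, let $p\in[0,1]$, and let $X_0$ be a random variable with law $(1-p)\delta_0+p\,P_{X_0^*}$, where $\delta_0$ is the Dirac mass at $0$ and $P_{X_0^*}$ the law of $X_0^*$. Let $(X_n)_{n\ge 0}$ be the Derrida–Retaux system started from $X_0$: for every $n\ge 0$, $X_{n+1}$ has the law of $(X_{n,1}+\cdots+X_{n,m}-1)^+$, where $X_{n,1},\dots,X_{n,m}$ are independent copies of $X_n$ and $a^+=\max\{a,0\}$. Put $$n_2:=\left\lfloor \frac{\log\big(1/\mathbb P(X_0^*\ge 2)\big)}{\log(5/4)}\right\rfloor+1,\qquad X_i^{(M)}:=X_i\wedge(M-i)\quad (M>i\ge 0).$$ Let $M\ge n_2+2$ be an integer and suppose that, for some integer $i\in[n_2,M-2]$ and some real $s\in[1,m-\delta]$, $$\mathbb E\Big(\big[(m-1)X_i^{(M)}-1\big]\,s^{X_i^{(M)}}\Big)\ge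 0 .$$ Then $$\mathbb P(X_n=0)\le c_7\,e^{-c_6\,m^{\,n-M}}\qquad\text{for all integers } n\ge M .$$ -/

import Mathlib

open MeasureTheory

/-- A Derrida–Retaux system with branching number `m`: a sequence of random variables `X n` with
values in `ℕ` such that `X (n + 1)` has the law of `(X_{n,1} + ⋯ + X_{n,m} - 1)⁺`, where
`X_{n,1}, …, X_{n,m}` are independent copies of `X n`, that is, where the vector of them is
distributed as the `m`-fold product of the law of `X n`. The subtraction is the truncated one of
`ℕ`, which is the positive part of the difference. -/
structure IsDerridaRetauxSystem {Ω : Type*} [MeasurableSpace Ω] (P : Measure Ω) (m : ℕ)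
    (X : ℕ → Ω → ℕ) : Prop where
  measurable : ∀ n, Measurable (X n)
  law_succ : ∀ n, P.map (X (n + 1)) =
    (Measure.pi fun _ : Fin m => P.map (X n)).map fun x => (∑ j, x j) - 1

/-- The law of `X₀` is the mixture `(1 - p) δ₀ + p P_{X₀*}`. -/
def HasMixtureLaw {Ω : Type*} [MeasurableSpace Ω] (P : Measure Ω) (X₀ : Ω → ℕ) (p : ℝ)
    {Ω' : Type*} [MeasurableSpace Ω'] (P' : Measure Ω') (Xstar : Ω' → ℕ) : Prop :=
  P.map X₀ = ENNReal.ofReal (1 - p) • Measure.dirac 0 + ENNReal.ofReal p • P'.map Xstar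

/-- The integer `n₂ = ⌊log (1 / q) / log (5 / 4)⌋ + 1`, to be used with `q = P(X₀* ≥ 2) ∈ (0, 1]`
(so that the quotient is nonnegative). -/
noncomputable def nTwo (q : ℝ) : ℕ :=
  ⌊Real.log (1 / q) / Real.log (5 / 4)⌋₊ + 1

/-- The truncated variable `X_i^{(M)} = X_i ∧ (M - i)`, for `i < M`. -/
def truncatedVar {Ω : Type*} (X : ℕ → Ω → ℕ) (M i : ℕ) (ω : Ω) : ℕ :=
  min (X i ω) (M - i)

/-! Call time `n₀` strongly supercritical if `E (3/4)^X ≤ (191/192) * (3/4)` for `X = X_{n₀}`. Since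
`E u^{X_{n+1}} ≤ (E u^{X_n})^m / u`, this bound improves doubly exponentially
(`integral_pow_add_le`), and `P(X_n = 0)` with it. So it suffices to find such an `n₀ ≤ M + C`, with
`C` depending only on `(m, δ)` (`exists_integral_pow_le`).

Two situations give `n₀` directly: a tail `P(X_n ≥ y) > m^(4-y)`, because one large copy among
`m^(y-4)` survives the subtractions, and a small mass at `0` at time `i ≥ n₂`.

Otherwise `P(X_i = 0)` is bounded below. Raising the base from `s = m - δ` to `t = m - δ/2` scales
the positive part of the weight by at least `t/s` but leaves its value `-1` at `0`. Since the tails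
are light, a nonnegative mean thus becomes a mean at least `η > 0` with the truncation at a constant
level `K`. Each step of the recursion multiplies this mean by at least `m/t > 1`
(`integral_drWeight_succ`), whereas light tails keep it bounded. After a constant number `N` of
steps some tail must therefore be heavy. -/

/-- The laws of a Derrida–Retaux system. -/
def IsDerridaRetauxLaw (m : ℕ) (μ : ℕ → Measure ℕ) : Prop :=
  ∀ n, μ (n + 1) = (Measure.pi fun _ : Fin m => μ n).map fun x => (∑ j, x j) - 1

/-- The function `x ↦ ((m - 1) x - 1) s ^ x`. -/
noncomputable def drWeight (m : ℕ) (s : ℝ) (x : ℕ) : ℝ := (((m : ℝ) - 1) * x - 1) * s ^ x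

/-! ### Integrals and masses on `ℕ`. -/

theorem integrable_of_forall_abs_le {α : Type*} [MeasurableSpace α] [DiscreteMeasurableSpace α]
    (μ : Measure α) [IsFiniteMeasure μ] {f : α → ℝ} (C : ℝ) (hf : ∀ x, |f x| ≤ C) :
    Integrable f μ :=
  Integrable.of_bound (Measurable.of_discrete.aestronglyMeasurable) C (ae_of_all _ hf)

theorem integrable_comp_min (μ : Measure ℕ) [IsFiniteMeasure μ] (f : ℕ → ℝ) (K : ℕ) :
    Integrable (fun x => f (min x K)) μ := by
  refine integrable_of_forall_abs_le μ (∑ y ∈ Finset.range (K + 1), |f y|) fun x => ?_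
  exact Finset.single_le_sum (f := fun y => |f y|) (fun _ _ => abs_nonneg _)
    (Finset.mem_range.2 (by omega))

theorem integrable_indicator_one (μ : Measure ℕ) [IsFiniteMeasure μ] (S : Set ℕ) :
    Integrable (S.indicator (fun _ => (1 : ℝ))) μ :=
  integrable_of_forall_abs_le μ 1 fun x => by
    by_cases h : x ∈ S <;> simp [h]

theorem integral_indicator_one_real (μ : Measure ℕ) (S : Set ℕ) :
    ∫ x, S.indicator (fun _ => (1 : ℝ)) x ∂μ = μ.real S := by
  rw [integral_indicator_const _ (MeasurableSet.of_discrete)]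
  simp

theorem integrable_pow_of_le_one (μ : Measure ℕ) [IsFiniteMeasure μ] {u : ℝ} (hu : 0 ≤ u)
    (hu1 : u ≤ 1) : Integrable (fun x => u ^ x) μ :=
  integrable_of_forall_abs_le μ 1 fun x => by
    rw [abs_of_nonneg (by positivity)]; exact pow_le_one₀ hu hu1

theorem measureReal_lt_eq_one_sub (μ : Measure ℕ) [IsProbabilityMeasure μ] (y : ℕ) :
    μ.real {x | x < y} = 1 - μ.real {x | y ≤ x} := by
  have : {x : ℕ | x < y} = {x | y ≤ x}ᶜ := by ext; simp
  rw [this, probReal_compl_eq_one_sub (MeasurableSet.of_discrete)]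

theorem measureReal_zero_eq_one_sub (μ : Measure ℕ) [IsProbabilityMeasure μ] :
    μ.real {0} = 1 - μ.real {x | 1 ≤ x} := by
  rw [← measureReal_lt_eq_one_sub]
  congr 1; ext; simp

/-! ### Generating function and lower tail along the recursion. -/

namespace IsDerridaRetauxLaw

variable {m : ℕ} {μ : ℕ → Measure ℕ}

theorem integral_succ (h : IsDerridaRetauxLaw m μ) (n : ℕ) (f : ℕ → ℝ) :
    ∫ x, f x ∂μ (n + 1) = ∫ x : Fin m → ℕ, f ((∑ j, x j) - 1) ∂Measure.pi fun _ => μ n := by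
  rw [h n, integral_map (Measurable.of_discrete.aemeasurable)
    (Measurable.of_discrete.aestronglyMeasurable)]

variable [∀ n, IsProbabilityMeasure (μ n)]

theorem integral_pow_succ_le (h : IsDerridaRetauxLaw m μ) (n : ℕ) {u : ℝ} (hu : 0 < u)
    (hu1 : u ≤ 1) : ∫ x, u ^ x ∂μ (n + 1) ≤ (∫ x, u ^ x ∂μ n) ^ m / u := by
  have h1 : ∫ x : Fin m → ℕ, ∏ j, u ^ x j ∂(Measure.pi fun _ => μ n) =
      (∫ x, u ^ x ∂μ n) ^ m := by
    rw [integral_fintype_prod_eq_prod (𝕜 := ℝ) (fun _ : Fin m => fun x : ℕ => u ^ x)]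
    simp
  rw [h.integral_succ, ← h1, ← integral_div]
  have hb (k : ℕ) : |u ^ k| ≤ 1 := by
    rw [abs_of_nonneg (by positivity)]; exact pow_le_one₀ hu.le hu1
  refine integral_mono (integrable_of_forall_abs_le _ 1 fun x => hb _)
    (integrable_of_forall_abs_le _ (1 / u) fun x => ?_) fun x => ?_
  · rw [Finset.prod_pow_eq_pow_sum, abs_div, abs_of_pos hu]
    gcongr; exact hb _
  · simp only [Finset.prod_pow_eq_pow_sum]
    rw [le_div_iff₀ hu, ← pow_succ]
    exact pow_le_pow_of_le_one hu.le hu1 (by omega)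

/-- Every copy is at most the sum, so a small sum forces all `m` independent copies to be small. -/
theorem measureReal_lt_succ_le (h : IsDerridaRetauxLaw m μ) (n y : ℕ) :
    (μ (n + 1)).real {x | x < y} ≤ (μ n).real {x | x < y + 1} ^ m := by
  rw [h n, map_measureReal_apply Measurable.of_discrete MeasurableSet.of_discrete]
  calc (Measure.pi fun _ : Fin m => μ n).real _
      ≤ (Measure.pi fun _ : Fin m => μ n).real (Set.univ.pi fun _ => {x | x < y + 1}) := by
        refine measureReal_mono (fun x hx j _ => ?_)
        have := Finset.single_le_sum (f := x) (fun _ _ => Nat.zero_le _) (Finset.mem_univ j)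
        simp only [Set.mem_preimage, Set.mem_ofPred_eq] at hx ⊢
        omega
    _ = _ := by
        simp [Measure.real, Measure.pi_pi, ENNReal.toReal_pow]

theorem measureReal_lt_add_le (h : IsDerridaRetauxLaw m μ) (n k y : ℕ) :
    (μ (n + k)).real {x | x < y} ≤ (μ n).real {x | x < y + k} ^ m ^ k := by
  induction k generalizing y with
  | zero => simp
  | succ k ih =>
    refine (h.measureReal_lt_succ_le (n + k) y).trans ?_
    refine (pow_le_pow_left₀ measureReal_nonneg (ih (y + 1)) m).trans (le_of_eq ?_)
    rw [← pow_mul, ← pow_succ, add_assoc, add_comm 1 k]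

/-- A strongly supercritical bound propagates to a doubly exponential decay. -/
theorem integral_pow_add_le (h : IsDerridaRetauxLaw m μ) (hm : 2 ≤ m) {u ρ : ℝ} (hu : 0 < u)
    (hu1 : u ≤ 1) (n : ℕ) (hn : ∫ x, u ^ x ∂μ n ≤ ρ * u) (k : ℕ) :
    ∫ x, u ^ x ∂μ (n + k) ≤ ρ ^ m ^ k * u := by
  induction k with
  | zero => simpa using hn
  | succ k ih =>
    have h0 : 0 ≤ ∫ x, u ^ x ∂μ (n + k) := integral_nonneg fun x => by positivity
    -- The sign of `ρ` is not assumed; it is inherited from the integral.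
    have hρ : 0 ≤ ρ ^ m ^ k := by
      by_contra hc
      push Not at hc
      nlinarith
    calc ∫ x, u ^ x ∂μ (n + k + 1) ≤ (∫ x, u ^ x ∂μ (n + k)) ^ m / u :=
          h.integral_pow_succ_le _ hu hu1
      _ ≤ (ρ ^ m ^ k * u) ^ m / u := by gcongr
      _ = ρ ^ m ^ (k + 1) * (u ^ m / u) := by rw [mul_pow, ← pow_mul, ← pow_succ, mul_div_assoc]
      _ ≤ ρ ^ m ^ (k + 1) * u := by
          gcongr
          · rw [pow_succ, pow_mul]; exact pow_nonneg hρ m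
          · rw [div_le_iff₀ hu, ← sq]
            exact pow_le_pow_of_le_one hu.le hu1 hm

end IsDerridaRetauxLaw

/-! ### Generating function against point and tail masses. -/

theorem measureReal_zero_le_integral_pow (μ : Measure ℕ) [IsProbabilityMeasure μ] {u : ℝ}
    (hu : 0 ≤ u) (hu1 : u ≤ 1) : μ.real {0} ≤ ∫ x, u ^ x ∂μ := by
  rw [← integral_indicator_one_real]
  refine integral_mono (integrable_indicator_one _ _) (integrable_pow_of_le_one _ hu hu1)
    fun x => ?_
  rcases Nat.eq_zero_or_pos x with rfl | hx
  · simp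
  · simp [hx.ne']; positivity

theorem integral_pow_le_add (μ : Measure ℕ) [IsProbabilityMeasure μ] {u : ℝ}
    (hu : 0 ≤ u) (hu1 : u ≤ 1) (k : ℕ) :
    ∫ x, u ^ x ∂μ ≤ u ^ k + (1 - u ^ k) * μ.real {x | x < k} := by
  rw [← integral_indicator_one_real, ← integral_const_mul]
  have hi := integrable_indicator_one μ {x | x < k}
  have hc : Integrable (fun _ : ℕ => u ^ k) μ := integrable_const _
  have : u ^ k = ∫ _, u ^ k ∂μ := by simp
  rw [this, ← integral_add hc (hi.const_mul _)]
  refine integral_mono (integrable_pow_of_le_one _ hu hu1) (hc.add (hi.const_mul _)) fun x => ?_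
  by_cases hx : x < k
  · simpa [hx] using pow_le_one₀ hu hu1
  · simp [hx]; exact pow_le_pow_of_le_one hu hu1 (by omega)

/-- Keeps the exact value `u` at `1`, so that it is useful even if most of the mass sits there, as
may happen for `m = 2`. -/
theorem integral_pow_le_of_le_two (μ : Measure ℕ) [IsProbabilityMeasure μ] {u : ℝ}
    (hu : 0 ≤ u) (hu1 : u ≤ 1) :
    ∫ x, u ^ x ∂μ ≤ u + (1 - u) * μ.real {0} - (u - u ^ 2) * μ.real {x | 2 ≤ x} := by
  rw [← integral_indicator_one_real, ← integral_indicator_one_real, ← integral_const_mul,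
    ← integral_const_mul]
  have hi := (integrable_indicator_one μ {0}).const_mul (1 - u)
  have hj := (integrable_indicator_one μ {x | 2 ≤ x}).const_mul (u - u ^ 2)
  have hc : Integrable (fun _ : ℕ => u) μ := integrable_const _
  have : u = ∫ _, u ∂μ := by simp
  nth_rw 2 [this]
  have hci : Integrable (fun x => u + (1 - u) * Set.indicator {0} (fun _ => (1 : ℝ)) x) μ :=
    hc.add hi
  rw [← integral_add hc hi, ← integral_sub hci hj]
  refine integral_mono (integrable_pow_of_le_one _ hu hu1) (hci.sub hj) fun x => ?_
  match x with
  | 0 => simp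
  | 1 => simp
  | x + 2 => simpa using pow_le_pow_of_le_one hu hu1 (by omega : 2 ≤ x + 2)

/-! ### The weight `drWeight` -/

theorem drWeight_zero (m : ℕ) (s : ℝ) : drWeight m s 0 = -1 := by simp [drWeight]

theorem drWeight_succ_nonneg {m : ℕ} (hm : 2 ≤ m) {s : ℝ} (hs : 0 ≤ s) (x : ℕ) :
    0 ≤ drWeight m s (x + 1) := by
  have : (2 : ℝ) ≤ m := by exact_mod_cast hm
  refine mul_nonneg ?_ (by positivity)
  push_cast
  nlinarith [(Nat.cast_nonneg x : (0 : ℝ) ≤ x)]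

theorem drWeight_mono {m : ℕ} (hm : 2 ≤ m) {s : ℝ} (hs : 1 ≤ s) : Monotone (drWeight m s) := by
  have hm' : (2 : ℝ) ≤ m := by exact_mod_cast hm
  refine monotone_nat_of_le_succ fun x => ?_
  rcases x with _ | x
  · rw [drWeight_zero]
    linarith [drWeight_succ_nonneg hm (by linarith : 0 ≤ s) 0]
  · have h := drWeight_succ_nonneg hm (by linarith : 0 ≤ s) x
    unfold drWeight at h ⊢
    rw [pow_succ s (x + 1)]
    have hp : 0 ≤ s ^ (x + 1) := by positivity
    have h2 : 0 ≤ ((m : ℝ) - 1) * ((x + 1 + 1 : ℕ) : ℝ) - 1 := by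
      push_cast
      nlinarith [(Nat.cast_nonneg x : (0 : ℝ) ≤ x)]
    calc _ ≤ (((m : ℝ) - 1) * ((x + 1 + 1 : ℕ) : ℝ) - 1) * s ^ (x + 1) := by
          gcongr
          · linarith
          · omega
      _ ≤ _ := by
          gcongr
          exact le_mul_of_one_le_right hp hs

/-- Raising the base multiplies the positive part of the weight at least by the ratio. -/
theorem div_mul_drWeight_le {m : ℕ} (hm : 2 ≤ m) {s t : ℝ} (hs : 0 < s) (hst : s ≤ t) (x : ℕ) :
    t / s * drWeight m s (x + 1) ≤ drWeight m t (x + 1) := by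
  have h := drWeight_succ_nonneg hm zero_le_one x
  unfold drWeight at h ⊢
  rw [one_pow, mul_one] at h
  have ht : 0 ≤ t := by linarith
  have : t / s * s ^ (x + 1) ≤ t ^ (x + 1) := by
    have h1 : t / s * s ^ (x + 1) = t * s ^ x := by rw [pow_succ]; field_simp
    rw [h1, pow_succ' t]
    gcongr
  calc _ = (((m : ℝ) - 1) * ((x + 1 : ℕ) : ℝ) - 1) * (t / s * s ^ (x + 1)) := by ring
    _ ≤ _ := by gcongr

theorem drWeight_le_of_le {m : ℕ} (hm : 2 ≤ m) {s t : ℝ} (hs : 0 < s) (hst : s ≤ t) (x : ℕ) :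
    drWeight m s x ≤ drWeight m t x := by
  rcases x with _ | x
  · simp [drWeight_zero]
  · have h := drWeight_succ_nonneg hm hs.le x
    refine le_trans ?_ (div_mul_drWeight_le hm hs hst x)
    exact le_mul_of_one_le_left h ((one_le_div hs).2 hst)

theorem drWeight_le (m : ℕ) {s : ℝ} (hs : 0 ≤ s) (x : ℕ) : drWeight m s x ≤ m * x * s ^ x := by
  unfold drWeight
  gcongr
  nlinarith [(Nat.cast_nonneg x : (0 : ℝ) ≤ x)]

/-- Comparison of the weights truncated at two levels, with an error carried by the values
above the first level. -/
theorem drWeight_min_comparison {m : ℕ} (hm : 2 ≤ m) {s t : ℝ} (hs : 1 ≤ s) (hst : s ≤ t)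
    {K : ℕ} (hK : 1 ≤ K) (L x : ℕ) :
    t / s * drWeight m s (min x L) + (t / s - 1) * Set.indicator {0} (fun _ => (1 : ℝ)) x ≤
      drWeight m t (min x K) + t / s * ∑ y ∈ Finset.Icc K L,
        m * y * s ^ y * Set.indicator {x | y ≤ x} (fun _ => (1 : ℝ)) x := by
  have hs0 : 0 < s := by linarith
  have hr : 1 ≤ t / s := (one_le_div hs0).2 hst
  have hterm (y : ℕ) :
      0 ≤ (m : ℝ) * y * s ^ y * Set.indicator {x | y ≤ x} (fun _ => (1 : ℝ)) x :=
    mul_nonneg (by positivity) (Set.indicator_nonneg (fun _ _ => zero_le_one) _)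
  have hsum := mul_nonneg (by linarith : 0 ≤ t / s)
    (Finset.sum_nonneg fun y (_ : y ∈ Finset.Icc K L) => hterm y)
  rcases x with _ | x
  · simp only [Nat.zero_min, drWeight_zero, Set.indicator_of_mem (Set.mem_singleton 0)]
    linarith
  have hx0 : Set.indicator {0} (fun _ => (1 : ℝ)) (x + 1) = 0 := by simp
  rw [hx0, mul_zero, add_zero]
  -- If both `x + 1` and `L` reach `K`, the single term `y = min (x + 1) L` pays for the whole
  -- weight; otherwise truncating at `K` loses nothing.
  by_cases hKL : K ≤ L ∧ K ≤ x + 1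
  · have hmem : min (x + 1) L ∈ Finset.Icc K L := by simp; omega
    have h1 := Finset.single_le_sum (fun y _ => hterm y) hmem
    rw [Set.indicator_of_mem (by simp), mul_one] at h1
    have h2 := (drWeight_le m hs0.le (min (x + 1) L)).trans h1
    have h3 : 0 ≤ drWeight m t (min (x + 1) K) := by
      obtain ⟨k, hk⟩ : ∃ k, min (x + 1) K = k + 1 := ⟨min (x + 1) K - 1, by omega⟩
      rw [hk]; exact drWeight_succ_nonneg hm (by linarith) k
    have := mul_le_mul_of_nonneg_left h2 (by linarith : 0 ≤ t / s)
    linarith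
  · have h1 : t / s * drWeight m s (min (x + 1) L) ≤ t / s * drWeight m s (min (x + 1) K) := by
      gcongr
      exact drWeight_mono hm hs (by omega)
    obtain ⟨k, hk⟩ : ∃ k, min (x + 1) K = k + 1 := ⟨min (x + 1) K - 1, by omega⟩
    have h2 := div_mul_drWeight_le hm hs0 hst k
    rw [← hk] at h2
    linarith

/-- The tail estimate: if the probabilities `μ [y, ∞)` decay like `m ^ (4 - y)`, then the tail of
the weighted mean is small. -/
theorem integral_drWeight_min_comparison (μ : Measure ℕ) [IsProbabilityMeasure μ] {m : ℕ}
    (hm : 2 ≤ m) {s t : ℝ} (hs : 1 ≤ s) (hst : s ≤ t) {K : ℕ} (hK : 1 ≤ K) (L : ℕ)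
    (htail : ∀ y ∈ Finset.Icc K L, μ.real {x | y ≤ x} * m ^ y ≤ m ^ 4) :
    t / s * ∫ x, drWeight m s (min x L) ∂μ + (t / s - 1) * μ.real {0} ≤
      ∫ x, drWeight m t (min x K) ∂μ +
        t / s * (m ^ 5 * ∑ y ∈ Finset.Icc K L, (y : ℝ) * (s / m) ^ y) := by
  have hm0 : (0 : ℝ) < m := by exact_mod_cast (by omega : 0 < m)
  have hr : 0 ≤ t / s := div_nonneg (by linarith) (by linarith)
  have i1 := (integrable_comp_min μ (drWeight m s) L).const_mul (t / s)
  have i2 := (integrable_indicator_one μ {0}).const_mul (t / s - 1)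
  have i3 := integrable_comp_min μ (drWeight m t) K
  have i4 (y : ℕ) := (integrable_indicator_one μ {x | y ≤ x}).const_mul (m * y * s ^ y)
  have i5 := (integrable_finsetSum (Finset.Icc K L) fun y _ => i4 y).const_mul (t / s)
  have h := integral_mono (i1.add i2) (i3.add i5) fun x =>
    drWeight_min_comparison hm hs hst hK L x
  simp only [Pi.add_apply] at h
  rw [integral_add i1 i2, integral_add i3 i5, integral_const_mul, integral_const_mul,
    integral_const_mul, integral_finsetSum _ fun y _ => i4 y, integral_indicator_one_real] at h
  refine h.trans ?_
  gcongr
  rw [Finset.mul_sum]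
  gcongr with y hy
  rw [integral_const_mul, integral_indicator_one_real]
  have h2 : m * y * s ^ y * μ.real {x | y ≤ x} =
      m * (y * (s / m) ^ y) * (μ.real {x | y ≤ x} * m ^ y) := by
    rw [div_pow]; field_simp
  rw [h2]
  calc _ ≤ (m : ℝ) * (y * (s / m) ^ y) * m ^ 4 := by
        gcongr
        exact htail y hy
    _ = _ := by ring

namespace IsDerridaRetauxLaw

/-- One step of the recursion multiplies the truncated weighted mean at least by `m / s`. -/
theorem integral_drWeight_succ {m : ℕ} {μ : ℕ → Measure ℕ} [∀ n, IsProbabilityMeasure (μ n)]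
    (h : IsDerridaRetauxLaw m μ) (hm : 2 ≤ m) {s : ℝ} (hs : 1 ≤ s) (hsm : s ≤ m) (n K : ℕ)
    (h0 : 0 ≤ ∫ x, drWeight m s (min x K) ∂μ n) :
    m / s * ∫ x, drWeight m s (min x K) ∂μ n ≤
      ∫ x, drWeight m s (min x (m * K)) ∂μ (n + 1) := by
  classical
  have hs0 : 0 < s := by linarith
  have hm0 : (0 : ℝ) < m := by linarith
  set D := ∫ x, drWeight m s (min x K) ∂μ n with hD
  set G := ∫ x, s ^ (min x K) ∂μ n with hG
  have hG1 : 1 ≤ G := by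
    have : (1 : ℝ) = ∫ _, (1 : ℝ) ∂μ n := by simp
    rw [this, hG]
    exact integral_mono (integrable_const _) (integrable_comp_min _ (fun x => s ^ x) K)
      fun x => one_le_pow₀ hs
  let g : Fin m → Fin m → ℕ → ℝ := fun j k x =>
    if k = j then drWeight m s (min x K) else s ^ (min x K)
  have hint (j : Fin m) :
      ∫ x : Fin m → ℕ, ∏ k, g j k (x k) ∂(Measure.pi fun _ => μ n) = D * G ^ (m - 1) := by
    rw [integral_fintype_prod_eq_prod (𝕜 := ℝ) (g j), ← Finset.mul_prod_erase _ _ (Finset.mem_univ j)]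
    congr 1
    · simp [g, hD]
    · rw [Finset.prod_congr rfl (g := fun _ => G)]
      · simp
      · intro k hk
        simp [g, Finset.ne_of_mem_erase hk, hG]
  have hprod (j : Fin m) (x : Fin m → ℕ) : ∏ k, g j k (x k) =
      (((m : ℝ) - 1) * (min (x j) K : ℕ) - 1) * s ^ ∑ k, min (x k) K := by
    rw [← Finset.prod_pow_eq_pow_sum, ← Finset.mul_prod_erase _ _ (Finset.mem_univ j),
      ← Finset.mul_prod_erase _ (fun k => s ^ min (x k) K) (Finset.mem_univ j), ← mul_assoc]
    congr 1
    · simp [g, drWeight]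
    · refine Finset.prod_congr rfl fun k hk => ?_
      simp [g, Finset.ne_of_mem_erase hk]
  -- With `S` the truncated sum, this is `s` times the weight at `S - 1` when `S ≥ 1`: the weight is
  -- tailored to the recursion.
  have hsumprod (x : Fin m → ℕ) : ∑ j, ∏ k, g j k (x k) =
      (((m : ℝ) - 1) * (∑ k, min (x k) K : ℕ) - m) * s ^ ∑ k, min (x k) K := by
    simp_rw [hprod]
    rw [← Finset.sum_mul]
    congr 1
    rw [Finset.sum_sub_distrib, ← Finset.mul_sum]
    simp
  have hgb (j : Fin m) : Integrable (fun x : Fin m → ℕ => ∏ k, g j k (x k))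
      (Measure.pi fun _ => μ n) := by
    refine Integrable.fintype_prod (𝕜 := ℝ) (f := g j) fun k => ?_
    by_cases hk : k = j
    · simpa [g, hk] using integrable_comp_min (μ n) (drWeight m s) K
    · simpa [g, hk] using integrable_comp_min (μ n) (fun x => s ^ x) K
  have hsI := (integrable_finsetSum Finset.univ fun j _ => hgb j).div_const s
  have hmain : ∫ x : Fin m → ℕ, (∑ j, ∏ k, g j k (x k)) / s ∂(Measure.pi fun _ => μ n) =
      m / s * (D * G ^ (m - 1)) := by
    rw [integral_div, integral_finsetSum _ fun j _ => hgb j]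
    simp_rw [hint]
    simp
    ring
  calc m / s * D ≤ m / s * (D * G ^ (m - 1)) := by
        gcongr
        exact le_mul_of_one_le_right h0 (one_le_pow₀ hG1)
    _ ≤ _ := by
        rw [← hmain, h.integral_succ]
        refine integral_mono hsI ?_ fun x => ?_
        · refine integrable_of_forall_abs_le _
            (∑ y ∈ Finset.range (m * K + 1), |drWeight m s y|) fun x => ?_
          exact Finset.single_le_sum (f := fun y => |drWeight m s y|) (fun _ _ => abs_nonneg _)
            (Finset.mem_range.2 (by omega))
        · simp only [hsumprod]
          have hle : ∑ k, min (x k) K ≤ ∑ k, x k := Finset.sum_le_sum fun k _ => min_le_left _ _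
          have hle2 : ∑ k, min (x k) K ≤ m * K := by
            refine (Finset.sum_le_sum fun k _ => min_le_right (x k) K).trans ?_
            simp
          refine le_trans ?_ (drWeight_mono hm hs
            (by omega : (∑ k, min (x k) K) - 1 ≤ min ((∑ j, x j) - 1) (m * K)))
          -- At `S = 0` the comparison is `-m / s ≤ -1`, the only place where the pointwise bound
          -- needs `s ≤ m`.
          rcases hS : ∑ k, min (x k) K with _ | S
          · simp only [drWeight_zero, Nat.zero_sub]
            rw [div_le_iff₀ hs0]
            simp
            linarith
          · unfold drWeight
            rw [div_le_iff₀ hs0, pow_succ, Nat.add_sub_cancel]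
            push_cast
            apply le_of_eq
            ring

theorem integral_drWeight_add {m : ℕ} {μ : ℕ → Measure ℕ} [∀ n, IsProbabilityMeasure (μ n)]
    (h : IsDerridaRetauxLaw m μ) (hm : 2 ≤ m) {s : ℝ} (hs : 1 ≤ s) (hsm : s ≤ m) (n K N : ℕ)
    (h0 : 0 ≤ ∫ x, drWeight m s (min x K) ∂μ n) :
    (m / s) ^ N * ∫ x, drWeight m s (min x K) ∂μ n ≤
      ∫ x, drWeight m s (min x (m ^ N * K)) ∂μ (n + N) := by
  have hr : 0 ≤ m / s := div_nonneg (by linarith) (by linarith)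
  induction N with
  | zero => simp
  | succ N ih =>
    have h1 := h.integral_drWeight_succ hm hs hsm (n + N) (m ^ N * K)
      ((mul_nonneg (pow_nonneg hr N) h0).trans ih)
    rw [pow_succ', mul_assoc, pow_succ' m, mul_assoc]
    exact (mul_le_mul_of_nonneg_left ih hr).trans h1

end IsDerridaRetauxLaw

/-! ### Small mass at zero -/

theorem integral_pi_two (μ : Measure ℕ) [IsProbabilityMeasure μ] (f g : ℕ → ℝ) :
    ∫ x : Fin 2 → ℕ, f (x 0) * g (x 1) ∂(Measure.pi fun _ => μ) =
      (∫ x, f x ∂μ) * ∫ x, g x ∂μ := by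
  have := integral_fintype_prod_eq_prod (𝕜 := ℝ) (ι := Fin 2) (μ := fun _ => μ) ![f, g]
  simpa [Fin.prod_univ_two] using this

theorem measureReal_le_one_eq (μ : Measure ℕ) [IsProbabilityMeasure μ] :
    μ.real {x | x ≤ 1} = 1 - μ.real {x | 2 ≤ x} := by
  rw [← measureReal_lt_eq_one_sub]
  congr 1; ext x; simp

namespace IsDerridaRetauxLaw

variable {μ : ℕ → Measure ℕ} [∀ n, IsProbabilityMeasure (μ n)]

/-- The rectangles `A × B` and `B × A` overlap inside `B × B`, hence the subtracted square. -/
theorem two_measureReal_succ_ge (h : IsDerridaRetauxLaw 2 μ) (n : ℕ) (A B C : Set ℕ)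
    (hC : ∀ x ∈ A, ∀ y ∈ B, x + y - 1 ∈ C) :
    2 * (μ n).real A * (μ n).real B - (μ n).real B ^ 2 ≤ (μ (n + 1)).real C := by
  let I : Set ℕ → ℕ → ℝ := fun S => S.indicator fun _ => 1
  have hI (S : Set ℕ) (x : ℕ) : |I S x| ≤ 1 := by by_cases hx : x ∈ S <;> simp [I, hx]
  have hint (S T : Set ℕ) : Integrable (fun x : Fin 2 → ℕ => I S (x 0) * I T (x 1))
      (Measure.pi fun _ => μ n) :=
    integrable_of_forall_abs_le _ 1 fun x => by
      rw [abs_mul]; exact mul_le_one₀ (hI _ _) (abs_nonneg _) (hI _ _)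
  have hval (S T : Set ℕ) : ∫ x : Fin 2 → ℕ, I S (x 0) * I T (x 1) ∂(Measure.pi fun _ => μ n) =
      (μ n).real S * (μ n).real T := by
    rw [integral_pi_two, integral_indicator_one_real, integral_indicator_one_real]
  have e : 2 * (μ n).real A * (μ n).real B - (μ n).real B ^ 2 =
      ∫ x : Fin 2 → ℕ, (I A (x 0) * I B (x 1) + I B (x 0) * I A (x 1)) - I B (x 0) * I B (x 1)
        ∂(Measure.pi fun _ => μ n) := by
    have hadd : Integrable (fun x : Fin 2 → ℕ => I A (x 0) * I B (x 1) + I B (x 0) * I A (x 1))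
        (Measure.pi fun _ => μ n) := (hint A B).add (hint B A)
    rw [integral_sub hadd (hint B B), integral_add (hint A B) (hint B A),
      hval, hval, hval]
    ring
  rw [e, ← integral_indicator_one_real, h.integral_succ]
  refine integral_mono (((hint A B).add (hint B A)).sub (hint B B))
    (integrable_of_forall_abs_le _ 1 fun x => hI _ _) fun x => ?_
  have h1 := hC (x 0)
  have h2 := hC (x 1)
  simp only [Fin.sum_univ_two]
  by_cases a0 : x 0 ∈ A <;> by_cases a1 : x 1 ∈ A <;> by_cases b0 : x 0 ∈ B <;>
    by_cases b1 : x 1 ∈ B <;> by_cases c : x 0 + x 1 - 1 ∈ C <;>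
    simp [I, a0, a1, b0, b1, c] <;>
    first
    | exact (c (h1 a0 _ b1)).elim
    | exact (c (by rw [add_comm]; exact h2 a1 _ b0)).elim

theorem two_measureReal_zero_succ_ge (h : IsDerridaRetauxLaw 2 μ) (n : ℕ) :
    (μ n).real {0} * (2 - (μ n).real {0} - 2 * (μ n).real {x | 2 ≤ x}) ≤
      (μ (n + 1)).real {0} := by
  have := h.two_measureReal_succ_ge n {x | x ≤ 1} {0} {0}
    (by rintro x hx y rfl; simp at *; omega)
  rw [measureReal_le_one_eq] at this
  linarith

theorem two_measureReal_two_le_succ_ge (h : IsDerridaRetauxLaw 2 μ) (n : ℕ) :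
    (μ n).real {x | 2 ≤ x} * (2 - 2 * (μ n).real {0} - (μ n).real {x | 2 ≤ x}) ≤
      (μ (n + 1)).real {x | 2 ≤ x} := by
  have := h.two_measureReal_succ_ge n {x | 1 ≤ x} {x | 2 ≤ x} {x | 2 ≤ x}
    (by intro x hx y hy; simp at *; omega)
  rw [measureReal_zero_eq_one_sub]
  linarith

/-- For `m = 2`, a small mass at `0` after a long time forces a substantial mass on `[2, ∞)`. -/
theorem two_measureReal_two_le_ge (h : IsDerridaRetauxLaw 2 μ) {p q : ℝ} (hq : 0 ≤ q)
    (hp0 : 1 - p ≤ (μ 0).real {0}) (hpq : p * q ≤ (μ 0).real {x | 2 ≤ x}) (n : ℕ)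
    (hn : 1 ≤ q * (5 / 4) ^ n) (hz : (μ n).real {0} < 1 / 4) :
    1 / 16 ≤ (μ n).real {x | 2 ≤ x} := by
  have key : ∀ n, (μ n).real {0} < 1 / 4 → 1 / 16 ≤ (μ n).real {x | 2 ≤ x} ∨
      3 / 4 * (q * (5 / 4) ^ n) ≤ (μ n).real {x | 2 ≤ x} := by
    intro n
    induction n with
    | zero =>
      intro hz
      right
      have : 3 / 4 * q ≤ p * q := by gcongr; linarith
      simpa using this.trans hpq
    | succ n ih =>
      intro hz
      have h1 := h.two_measureReal_zero_succ_ge n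
      have h2 := h.two_measureReal_two_le_succ_ge n
      have h3 : (μ n).real {x | 2 ≤ x} ≤ 1 - (μ n).real {0} := by
        rw [measureReal_zero_eq_one_sub, sub_sub_cancel]
        exact measureReal_mono fun x hx => by simp at *; omega
      have hz0 : 0 ≤ (μ n).real {0} := measureReal_nonneg
      have hQ0 : 0 ≤ (μ n).real {x | 2 ≤ x} := measureReal_nonneg
      set z := (μ n).real {0}
      set Q := (μ n).real {x | 2 ≤ x}
      rcases le_or_gt Q (1 / 4) with hQ | hQ
      -- When `Q ≤ 1/4`, a mass at `0` of at least `1/4` would persist; so it was small one step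
      -- earlier, and `Q` grows by `2 - 2 / 4 - 1 / 4 = 5 / 4`.
      · have hz4 : z < 1 / 4 := by
          by_contra hc
          push Not at hc
          nlinarith
        have h5 : 5 / 4 * Q ≤ (μ (n + 1)).real {x | 2 ≤ x} := by nlinarith
        rcases ih hz4 with h6 | h6
        · left; linarith
        · right
          rw [pow_succ]
          linarith
      -- Here `z ≤ 1 - Q` makes the next value at least `Q ^ 2 > 1 / 16`.
      · left; nlinarith
  rcases key n hz with h1 | h1 <;> linarith

end IsDerridaRetauxLaw

/-! ### Two sources of strong supercriticality. -/

namespace IsDerridaRetauxLaw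

variable {m : ℕ} {μ : ℕ → Measure ℕ} [∀ n, IsProbabilityMeasure (μ n)]

/-- If `m ^ (y - 4)` copies of `X n` are likely to contain one larger than `y`, then the system is
strongly supercritical at time `n + y - 4`. -/
theorem exists_integral_pow_le_of_tail (h : IsDerridaRetauxLaw m μ) (hm : 2 ≤ m) (n y : ℕ)
    (hy : (m : ℝ) ^ 4 < (μ n).real {x | y ≤ x} * m ^ y) :
    ∃ n₀ ≤ n + y, ∫ x, (3 / 4 : ℝ) ^ x ∂μ n₀ ≤ 191 / 192 * (3 / 4) := by
  have hm1 : (1 : ℝ) < m := by exact_mod_cast (by omega : 1 < m)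
  have h4 : 4 ≤ y := by
    have : (m : ℝ) ^ 4 < m ^ y := hy.trans_le
      (mul_le_of_le_one_left (by positivity) measureReal_le_one)
    exact ((pow_lt_pow_iff_right₀ hm1).1 this).le
  obtain ⟨k, rfl⟩ := Nat.exists_eq_add_of_le h4
  refine ⟨n + k, by omega, ?_⟩
  have h1 := h.measureReal_lt_add_le n k 4
  set t := (μ n).real {x | 4 + k ≤ x} with ht
  rw [measureReal_lt_eq_one_sub (μ n), ← ht] at h1
  have htk : 1 ≤ t * m ^ k := by
    rw [pow_add] at hy
    have : (0 : ℝ) < m ^ 4 := by positivity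
    nlinarith
  have ht1 : t ≤ 1 := measureReal_le_one
  have h2 : (1 - t) ^ m ^ k ≤ 1 / 2 := by
    calc (1 - t) ^ m ^ k ≤ Real.exp (-t) ^ m ^ k := by
          gcongr
          linarith [Real.add_one_le_exp (-t)]
      _ = Real.exp (-(t * m ^ k)) := by rw [← Real.exp_nat_mul]; push_cast; ring_nf
      _ ≤ Real.exp (-1) := by gcongr
      _ ≤ 1 / 2 := by
          rw [Real.exp_neg, one_div]
          gcongr
          linarith [Real.add_one_le_exp (1 : ℝ)]
  have h3 := integral_pow_le_add (μ (n + k)) (u := 3 / 4) (by norm_num) (by norm_num) 4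
  norm_num at h3 ⊢
  linarith

/-- If the mass at `0` is small, then the system is already strongly supercritical. -/
theorem exists_integral_pow_le_of_measureReal_zero (h : IsDerridaRetauxLaw m μ) (hm : 2 ≤ m)
    {p q : ℝ} (hq : 0 ≤ q) (hp0 : 1 - p ≤ (μ 0).real {0})
    (hpq : p * q ≤ (μ 0).real {x | 2 ≤ x}) (n : ℕ) (hn : 1 ≤ q * (5 / 4) ^ n)
    (hz : (μ n).real {0} < 1 / (16 * m)) :
    ∃ n₀ ≤ n + 1, ∫ x, (3 / 4 : ℝ) ^ x ∂μ n₀ ≤ 191 / 192 * (3 / 4) := by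
  -- For `m ≥ 3`, `m` positive copies already give a value at least `2`. For `m = 2` they need not,
  -- and the growth of `P(X ≥ 2)` is used; this case fixes `191/192`, as `3/4 + 1/128 - 3/256 =
  -- (191/192) * (3/4)`.
  rcases hm.eq_or_lt with rfl | hm3
  · refine ⟨n, by omega, ?_⟩
    norm_num at hz
    have h1 := h.two_measureReal_two_le_ge hq hp0 hpq n hn (by linarith)
    have h2 := integral_pow_le_of_le_two (μ n) (u := 3 / 4) (by norm_num) (by norm_num)
    norm_num at h2 ⊢
    linarith
  · refine ⟨n + 1, le_rfl, ?_⟩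
    have hm0 : (0 : ℝ) < m := by positivity
    have h1 : (1 - (μ n).real {0}) ^ m ≤ (μ (n + 1)).real {x | 2 ≤ x} := by
      rw [measureReal_zero_eq_one_sub, sub_sub_cancel, h n,
        map_measureReal_apply Measurable.of_discrete MeasurableSet.of_discrete]
      calc _ = (Measure.pi fun _ : Fin m => μ n).real (Set.univ.pi fun _ => {x | 1 ≤ x}) := by
            simp [Measure.real, Measure.pi_pi, ENNReal.toReal_pow]
        _ ≤ _ := by
            refine measureReal_mono fun x hx => ?_
            have hx' : ∀ j, 1 ≤ x j := fun j => hx j (Set.mem_univ j)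
            have := Finset.card_nsmul_le_sum Finset.univ x 1 fun j _ => hx' j
            rw [Finset.card_univ, Fintype.card_fin, smul_eq_mul, mul_one] at this
            change m ≤ ∑ j, x j at this
            change 2 ≤ (∑ j, x j) - 1
            omega
    have h2 := one_add_mul_le_pow (a := -(μ n).real {0})
      (by linarith [(measureReal_le_one : (μ n).real {0} ≤ 1)]) m
    rw [← sub_eq_add_neg] at h2
    have h3 : (μ n).real {0} * m < 1 / 16 := by
      rw [lt_div_iff₀ (by positivity)] at hz
      linarith
    have h4 := integral_pow_le_add (μ (n + 1)) (u := 3 / 4) (by norm_num) (by norm_num) 2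
    rw [measureReal_lt_eq_one_sub] at h4
    norm_num at h4 ⊢
    linarith

end IsDerridaRetauxLaw

/-! ### The criterion for laws. -/

theorem summable_natCast_mul_pow {r : ℝ} (hr0 : 0 ≤ r) (hr1 : r < 1) :
    Summable fun y : ℕ => (y : ℝ) * r ^ y := by
  have := summable_pow_mul_geometric_of_norm_lt_one (R := ℝ) 1 (r := r)
    (by rwa [Real.norm_of_nonneg hr0])
  simpa using this

theorem exists_sum_Icc_natCast_mul_pow_le {r : ℝ} (hr0 : 0 ≤ r) (hr1 : r < 1) {ε : ℝ}
    (hε : 0 < ε) : ∃ K : ℕ, 1 ≤ K ∧ ∀ L, ∑ y ∈ Finset.Icc K L, (y : ℝ) * r ^ y ≤ ε := by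
  obtain ⟨s, hs⟩ := (summable_iff_vanishing_norm.1 (summable_natCast_mul_pow hr0 hr1)) ε hε
  refine ⟨s.sup id + 1, by omega, fun L => ?_⟩
  refine (le_abs_self _).trans (hs _ ?_).le
  rw [Finset.disjoint_left]
  intro y hy hys
  have : y ≤ s.sup id := Finset.le_sup (f := id) hys
  simp at hy
  omega

/-- The supercriticality criterion in terms of laws. -/
theorem exists_integral_pow_le (m : ℕ) (hm : 2 ≤ m) (δ : ℝ) (hδ : δ ∈ Set.Ioo (0 : ℝ) 1) :
    ∃ C : ℕ, ∀ μ : ℕ → Measure ℕ, (∀ n, IsProbabilityMeasure (μ n)) →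
      IsDerridaRetauxLaw m μ → ∀ p q : ℝ, 0 ≤ q → 1 - p ≤ (μ 0).real {0} →
      p * q ≤ (μ 0).real {x | 2 ≤ x} → ∀ i L : ℕ, 2 ≤ L → 1 ≤ q * (5 / 4) ^ i →
      0 ≤ ∫ x, drWeight m (m - δ) (min x L) ∂μ i →
      ∃ n₀ ≤ i + L + C, ∫ x, (3 / 4 : ℝ) ^ x ∂μ n₀ ≤ 191 / 192 * (3 / 4) := by
  obtain ⟨hδ0, hδ1⟩ := hδ
  have hm2 : (2 : ℝ) ≤ m := by exact_mod_cast hm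
  set s : ℝ := m - δ with hs
  set t : ℝ := m - δ / 2 with ht
  have hs1 : 1 ≤ s := by linarith
  have hst : s < t := by linarith
  have htm : t < m := by linarith
  have hs0 : 0 < s := by linarith
  have ht0 : 0 < t := by linarith
  have hm0 : (0 : ℝ) < m := by linarith
  have hρ : 1 < t / s := (one_lt_div hs0).2 hst
  -- Half of the gain `(t / s - 1) * P(X_i = 0)`; the other half absorbs the tail beyond `K`.
  set η : ℝ := (t / s - 1) * (1 / (16 * m)) / 2 with hη
  have hη0 : 0 < η := div_pos (mul_pos (by linarith) (by positivity)) two_pos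
  obtain ⟨K, hK, hKsum⟩ := exists_sum_Icc_natCast_mul_pow_le (r := s / m) (by positivity)
    ((div_lt_one hm0).2 (by linarith)) (ε := η / (t / s * m ^ 5)) (by positivity)
  have htm1 : t / m < 1 := (div_lt_one hm0).2 htm
  obtain ⟨N, hN⟩ := pow_unbounded_of_one_lt
    ((m * t + m ^ 5 * ∑' y : ℕ, (y : ℝ) * (t / m) ^ y) / η) ((one_lt_div ht0).2 htm)
  refine ⟨N + m ^ N * K, fun μ _ h p q hq hp0 hpq i L hL hi hD => ?_⟩
  by_cases hz : (μ i).real {0} < 1 / (16 * m)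
  · obtain ⟨n₀, hn₀, hb⟩ :=
      h.exists_integral_pow_le_of_measureReal_zero hm hq hp0 hpq i hi hz
    exact ⟨n₀, by omega, hb⟩
  push Not at hz
  by_cases htail : ∀ y ∈ Finset.Icc K L, (μ i).real {x | y ≤ x} * m ^ y ≤ m ^ 4
  swap
  · push Not at htail
    obtain ⟨y, hy, hlt⟩ := htail
    obtain ⟨n₀, hn₀, hb⟩ := h.exists_integral_pow_le_of_tail hm i y hlt
    rw [Finset.mem_Icc] at hy
    exact ⟨n₀, by omega, hb⟩
  have h1 := integral_drWeight_min_comparison (μ i) hm hs1 hst.le hK L htail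
  have h2 : η ≤ ∫ x, drWeight m t (min x K) ∂μ i := by
    have h3 := mul_nonneg (by linarith : 0 ≤ t / s) hD
    have h4 : t / s * (m ^ 5 * ∑ y ∈ Finset.Icc K L, (y : ℝ) * (s / m) ^ y) ≤ η := by
      have := hKsum L
      rw [le_div_iff₀ (by positivity)] at this
      linarith
    have h5 : (t / s - 1) * (1 / (16 * m)) ≤ (t / s - 1) * (μ i).real {0} := by
      gcongr
    linarith
  have h3 := h.integral_drWeight_add hm (hs1.trans hst.le) htm.le i K N (hη0.le.trans h2)
  by_cases htail2 : ∀ y ∈ Finset.Icc 1 (m ^ N * K),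
      (μ (i + N)).real {x | y ≤ x} * m ^ y ≤ m ^ 4
  swap
  · push Not at htail2
    obtain ⟨y, hy, hlt⟩ := htail2
    obtain ⟨n₀, hn₀, hb⟩ := h.exists_integral_pow_le_of_tail hm (i + N) y hlt
    rw [Finset.mem_Icc] at hy
    exact ⟨n₀, by omega, hb⟩
  exfalso
  -- Equal bases and lower level `1`: light tails bound the mean by a constant, which the choice of
  -- `N` contradicts.
  have h4 := integral_drWeight_min_comparison (μ (i + N)) hm (hs1.trans hst.le) le_rfl le_rfl
    (m ^ N * K) htail2
  rw [div_self ht0.ne', sub_self, zero_mul, one_mul, one_mul, add_zero] at h4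
  have h5 : ∫ x, drWeight m t (min x 1) ∂μ (i + N) ≤ m * t := by
    have : (m * t : ℝ) = ∫ _, (m * t : ℝ) ∂μ (i + N) := by simp
    rw [this]
    refine integral_mono (integrable_comp_min _ _ 1) (integrable_const _) fun x => ?_
    refine (drWeight_mono hm (hs1.trans hst.le) (min_le_right x 1)).trans ?_
    simpa using drWeight_le m ht0.le 1
  have h6 : ∑ y ∈ Finset.Icc 1 (m ^ N * K), (y : ℝ) * (t / m) ^ y ≤
      ∑' y : ℕ, (y : ℝ) * (t / m) ^ y :=
    (summable_natCast_mul_pow (by positivity) htm1).sum_le_tsum _ fun y _ => by positivity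
  have h7 := mul_le_mul_of_nonneg_left h6 (by positivity : (0 : ℝ) ≤ m ^ 5)
  have h8 := mul_le_mul_of_nonneg_left h2 (by positivity : (0 : ℝ) ≤ (m / t) ^ N)
  rw [div_lt_iff₀ hη0] at hN
  linarith

/-! ### Back to random variables. -/

theorem one_le_mul_pow_of_nTwo_le {q : ℝ} (hq : 0 < q) {i : ℕ} (hi : nTwo q ≤ i) :
    1 ≤ q * (5 / 4 : ℝ) ^ i := by
  have hlog : 0 < Real.log (5 / 4) := Real.log_pos (by norm_num)
  have h1 : Real.log (1 / q) / Real.log (5 / 4) ≤ i := by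
    refine (Nat.lt_floor_add_one _).le.trans ?_
    exact_mod_cast hi
  rw [div_le_iff₀ hlog, ← Real.log_pow, Real.log_le_log_iff (by positivity) (by positivity),
    div_le_iff₀ hq] at h1
  linarith

theorem IsDerridaRetauxSystem.isDerridaRetauxLaw {Ω : Type*} [MeasurableSpace Ω] {P : Measure Ω}
    {m : ℕ} {X : ℕ → Ω → ℕ} (h : IsDerridaRetauxSystem P m X) :
    IsDerridaRetauxLaw m fun n => P.map (X n) :=
  h.law_succ

/-- The mass which the mixture puts on a set. -/
theorem HasMixtureLaw.measureReal_map {Ω : Type*} [MeasurableSpace Ω] {P : Measure Ω}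
    {X₀ : Ω → ℕ} {p : ℝ} {Ω' : Type*} [MeasurableSpace Ω']
    {P' : Measure Ω'} [IsProbabilityMeasure P'] {Xstar : Ω' → ℕ}
    (h : HasMixtureLaw P X₀ p P' Xstar) (hX : Measurable Xstar) (hp : p ∈ Set.Icc (0 : ℝ) 1)
    (S : Set ℕ) :
    (P.map X₀).real S = (1 - p) * (Measure.dirac 0 : Measure ℕ).real S +
      p * P'.real (Xstar ⁻¹' S) := by
  have := Measure.isProbabilityMeasure_map (μ := P') hX.aemeasurable
  rw [h, measureReal_add_apply (ENNReal.mul_ne_top ENNReal.ofReal_ne_top (measure_ne_top _ _))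
      (ENNReal.mul_ne_top ENNReal.ofReal_ne_top (measure_ne_top _ _)),
    measureReal_ennreal_smul_apply, measureReal_ennreal_smul_apply,
    ENNReal.toReal_ofReal (by linarith [hp.2]), ENNReal.toReal_ofReal hp.1,
    map_measureReal_apply hX MeasurableSet.of_discrete]

theorem mainTheorem4 (m : ℕ) (hm : 2 ≤ m) (δ : ℝ) (hδ : δ ∈ Set.Ioo (0 : ℝ) 1) :
    ∃ c₆ c₇ : ℝ, 0 < c₆ ∧ 0 < c₇ ∧
      ∀ (Ω' : Type*) [MeasurableSpace Ω'] (P' : Measure Ω') [IsProbabilityMeasure P']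
        (Xstar : Ω' → ℕ), Measurable Xstar → (∀ᵐ ω ∂P', 1 ≤ Xstar ω) →
        0 < P'.real {ω | 2 ≤ Xstar ω} →
      ∀ p ∈ Set.Icc (0 : ℝ) 1,
      ∀ (Ω : Type*) [MeasurableSpace Ω] (P : Measure Ω) [IsProbabilityMeasure P]
        (X : ℕ → Ω → ℕ), IsDerridaRetauxSystem P m X → HasMixtureLaw P (X 0) p P' Xstar →
      ∀ M : ℕ, nTwo (P'.real {ω | 2 ≤ Xstar ω}) + 2 ≤ M →
        (∃ i : ℕ, nTwo (P'.real {ω | 2 ≤ Xstar ω}) ≤ i ∧ i ≤ M - 2 ∧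
          ∃ s ∈ Set.Icc (1 : ℝ) ((m : ℝ) - δ),
            0 ≤ ∫ ω, (((m : ℝ) - 1) * (truncatedVar X M i ω : ℝ) - 1) *
              s ^ (truncatedVar X M i ω) ∂P) →
        ∀ n : ℕ, M ≤ n →
          P.real {ω | X n ω = 0} ≤ c₇ * Real.exp (-(c₆ * (m : ℝ) ^ (n - M))) := by
  obtain ⟨C, hC⟩ := exists_integral_pow_le m hm δ hδ
  have hm1 : (1 : ℝ) < m := by exact_mod_cast (by omega : 1 < m)
  have hm0 : (0 : ℝ) < m := by linarith
  set ℓ : ℝ := Real.log (192 / 191) with hℓ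
  have hℓ0 : 0 < ℓ := Real.log_pos (by norm_num)
  have hexp : (191 / 192 : ℝ) = Real.exp (-ℓ) := by
    rw [hℓ, ← Real.log_inv, Real.exp_log (by norm_num)]; norm_num
  -- The delay `n₀ ≤ M + C` costs the factor `m ^ C`; the constant `Real.exp ℓ` makes the bound
  -- trivial for `n ≤ n₀`.
  refine ⟨ℓ / m ^ C, Real.exp ℓ, by positivity, Real.exp_pos _, ?_⟩
  intro Ω' _ P' _ Xstar hXs _ hq p hp Ω _ P _ X hX hmix M hM ⟨i, hi, hiM, s, hs, hD⟩ n hn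
  have hprob : ∀ n, IsProbabilityMeasure (P.map (X n)) := fun n =>
    Measure.isProbabilityMeasure_map (hX.measurable n).aemeasurable
  have hlaw := hX.isDerridaRetauxLaw
  have h0 : 1 - p ≤ (P.map (X 0)).real {0} := by
    rw [hmix.measureReal_map hXs hp]
    simpa [Measure.real] using mul_nonneg hp.1 ENNReal.toReal_nonneg
  have h2 : p * P'.real {ω | 2 ≤ Xstar ω} ≤ (P.map (X 0)).real {x | 2 ≤ x} := by
    rw [hmix.measureReal_map hXs hp]
    have := mul_nonneg (by linarith [hp.2] : 0 ≤ 1 - p)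
      (measureReal_nonneg (μ := (Measure.dirac 0 : Measure ℕ)) (s := {x | 2 ≤ x}))
    simpa using this
  have hDi : 0 ≤ ∫ x, drWeight m (m - δ) (min x (M - i)) ∂P.map (X i) := by
    rw [integral_map (hX.measurable i).aemeasurable
      (Measurable.of_discrete.aestronglyMeasurable)]
    have hint (r : ℝ) : Integrable (fun ω => drWeight m r (min (X i ω) (M - i))) P :=
      (integrable_comp_min (P.map (X i)) (drWeight m r) (M - i)).comp_measurable
        (hX.measurable i)
    exact hD.trans (integral_mono (hint s) (hint (m - δ)) fun ω =>
      drWeight_le_of_le hm (by linarith [hs.1]) hs.2 _)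
  obtain ⟨n₀, hn₀, hb⟩ := hC _ hprob hlaw p _ hq.le h0 h2 i (M - i) (by omega)
    (one_le_mul_pow_of_nTwo_le hq hi) hDi
  replace hn₀ : n₀ ≤ M + C := by omega
  have hset : P.real {ω | X n ω = 0} = (P.map (X n)).real {0} := by
    rw [map_measureReal_apply (hX.measurable n) MeasurableSet.of_discrete]
    rfl
  have hmC : (0 : ℝ) < m ^ C := by positivity
  rw [hset, ← Real.exp_add]
  rcases le_total n₀ n with hle | hle
  · obtain ⟨k, rfl⟩ := Nat.exists_eq_add_of_le hle
    calc _ ≤ ∫ x, (3 / 4 : ℝ) ^ x ∂P.map (X (n₀ + k)) :=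
          measureReal_zero_le_integral_pow _ (by norm_num) (by norm_num)
      _ ≤ (191 / 192) ^ m ^ k * (3 / 4) :=
          hlaw.integral_pow_add_le hm (by norm_num) (by norm_num) n₀ hb k
      _ ≤ (191 / 192) ^ m ^ k := mul_le_of_le_one_right (by positivity) (by norm_num)
      _ = Real.exp (-(ℓ * m ^ k)) := by rw [hexp, ← Real.exp_nat_mul]; push_cast; ring_nf
      _ ≤ _ := by
          refine Real.exp_le_exp.2 ?_
          have h3 : ℓ / m ^ C * m ^ (n₀ + k - M) ≤ ℓ * m ^ k := by
            rw [div_mul_eq_mul_div, div_le_iff₀ hmC, mul_assoc, ← pow_add]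
            gcongr
            · exact hm1.le
            · omega
          linarith
  · refine measureReal_le_one.trans (Real.one_le_exp ?_)
    have h3 : ℓ / m ^ C * m ^ (n - M) ≤ ℓ := by
      rw [div_mul_eq_mul_div, div_le_iff₀ hmC]
      gcongr
      · exact hm1.le
      · omega
    linarith
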